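/- For every security parameter $\kappa\in\mathbb N$ let $\mathbb F=\mathbb F_\kappa$ be a finite field with $|\mathbb F|\ge 2^\kappa$, let $K,T>0$ and $N\ge K+T$ be integers (all of which may depend on $\kappa$), let $\alpha_1,\dots,\alpha_N\in\mathbb F$ be distinct, and fix an injective encoding of field elements as bit strings of some fixed length. Let $\mathsf H:\{0,1\}^*\to\{0,1\}^\kappa$ be a random oracle. *Hiding erasure-correcting code.* For $\mathbf m\in\mathbb F^K$ and $\mathbf s\in\mathbb F^T$ let $f(X)=\sum_{k=1}^K m_kX^{k-1}+\sum_{j=1}^T s_jX^{K-1+j}$ and $\mathsf{Enc}(\mathbf m,\mathbf s)=(f(\alpha_1),\dots,f(\alpha_N))\in\mathbb F^N$. *Salted Merkle tree.* Let $d$ be least with $N\le 2^d$; pad vectors in $\mathbb F^N$ with zeros to length $2^d$. Take the complete binary tree of depth $d$. Its $i$-th leaf is identified by the $d$-bit binary representation $\mathrm{leaf}(i)$ of $i-1$, and the node $b\in\{0,1,*\}^d$ that is $n\geq 1$ levels above the leaves is identified by the common first $d-n$ bits of the leaves below it followed by $n$ stars; identifiers are written as bit strings with two bits per symbol. For $\mathbf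 v,\mathbf r\in\mathbb F^N$ put $h_{\mathrm{leaf}(i)}=\mathsf H(\mathrm{leaf}(i)\,\|\,v_i\,\|\,r_i)$ at the leaves and $h_b=\mathsf H(b\,\|\,h_{b_{\mathrm L}}\,\|\,h_{b_{\mathrm R}})$ at every interior node $b$ with children $b_{\mathrm L},b_{\mathrm R}$. The commitment $\mathsf{Commit}(\mathbf v,\mathbf r)$ is the hash at the root, and the witness $\mathsf{Open}(\mathbf v,\mathbf r,i)$ is the list of the hashes at the siblings of the nodes on the path from leaf $i$ to the root. *Game.* A probabilistic adversary $\mathcal A$, which may query $\mathsf H$ at any time, provides $\mathbf v^{(0)},\mathbf v^{(1)}\in\mathbb F^N$. The challenger flips an unbiased coin $b\in\{0,1\}$, samples $\mathbf m'\in\mathbb F^K$ and $\mathbf r'\in\mathbb F^T$ uniformly at random (all independently of each other, of $\mathsf H$ and of the coins of $\mathcal A$), computes $\mathbf r=\mathsf{Enc}(\mathbf m',\mathbf r')$, and gives $C=\mathsf{Commit}(\mathbf v^{(b)},\mathbf r)$ to $\mathcal A$. Then $\mathcal A$ may adaptively make up to $T$ opening queries at distinct indices $i$ with $v^{(0)}_i=v^{(1)}_i$,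 and receives $r_i$ and $\mathsf{Open}(\mathbf v^{(b)},\mathbf r,i)$ for each (any other opening query is refused). Finally $\mathcal A$ outputs a guess $\hat b\in\{0,1\}$, and succeeds iff $\hat b=b$. *Claim.* For every PPT adversary $\mathcal A$, and more generally for every (possibly non-uniform and computationally unbounded) adversary for which there is a polynomial $p$ such that $\mathcal A$ makes at most $p(\kappa)$ queries to $\mathsf H$, the advantage $\bigl|\Pr[\hat b=b]-\tfrac12\bigr|$ is negligible in $\kappa$: for every $c>0$ there is an $n_0$ such that it is less than $1/\kappa^c$ for all $\kappa\ge n_0$. -/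

import Mathlib

open MeasureTheory

/-! ### Negligible functions, uniform sampling, the random oracle -/

/-- A function `f` is negligible if for every `c > 0`, eventually `f n < 1 / n ^ c`. -/
def Negligible (f : ℕ → ℝ) : Prop :=
  ∀ c : ℝ, 0 < c → ∃ n₀ : ℕ, ∀ n : ℕ, n₀ ≤ n → f n < 1 / (n : ℝ) ^ c

/-- The uniform distribution on a nonempty finite type. -/
noncomputable def uniformMeasure (α : Type*) [Fintype α] [Nonempty α] [MeasurableSpace α] :
    Measure α :=
  (PMF.uniformOfFintype α).toMeasure

/-- Hash values: bit strings of length `κ`. -/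
abbrev Digest (κ : ℕ) : Type := Fin κ → Bool

/-- Functions from all finite bit strings to bit strings of length `κ`. -/
abbrev Oracle (κ : ℕ) : Type := List Bool → Digest κ

/-- The law of the random oracle: the values at distinct bit strings are independent and uniform. -/
noncomputable def randomOracle (κ : ℕ) : Measure (Oracle κ) :=
  Measure.infinitePi fun _ : List Bool => uniformMeasure (Digest κ)

/-- The law of an infinite sequence of independent unbiased coin tosses. -/
noncomputable def coinTosses : Measure (ℕ → Bool) :=
  Measure.infinitePi fun _ : ℕ => uniformMeasure Bool

/-! ### Reed-Solomon hiding erasure-correcting code -/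

/-- The polynomial `∑ₖ mₖ Xᵏ + ∑ⱼ rⱼ X ^ (K + j)`, with `k` and `j` counted from `0`: its
coefficients are the message followed by the randomness. -/
noncomputable def heccPolynomial {F : Type*} [Field F] {K T : ℕ}
    (m : Fin K → F) (r : Fin T → F) : Polynomial F :=
  (∑ k : Fin K, Polynomial.C (m k) * Polynomial.X ^ (k : ℕ)) +
    ∑ j : Fin T, Polynomial.C (r j) * Polynomial.X ^ (K + (j : ℕ))

/-- The encoding: shred `i` is the value of the polynomial at the evaluation point `α i`. -/
noncomputable def heccEncode {F : Type*} [Field F] {N K T : ℕ} (α : Fin N → F)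
    (m : Fin K → F) (r : Fin T → F) : Fin N → F :=
  fun i => (heccPolynomial m r).eval (α i)

/-! ### Salted Merkle tree

Indices are counted from `0`. The node of height `n` and position `j` in the complete binary tree
of depth `d` (leaves have height `0`, the root has height `d`) has the children of height `n - 1`
at the positions `2 * j` and `2 * j + 1`. -/

/-- The identifier in `{0, 1, *}ᵈ` of the node of height `n` and position `j`: the `d - n` binary
digits of `j`, most significant first, followed by `n` stars. The star is `none`. -/
def nodeLabel (d n j : ℕ) : List (Option Bool) :=
  (List.range (d - n)).map (fun t => some (j.testBit (d - n - 1 - t))) ++ List.replicate n none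

/-- The symbols `0`, `1`, `*` as the bit pairs `00`, `01`, `10`. -/
def symbolBits : Option Bool → List Bool
  | some b => [false, b]
  | none => [true, false]

/-- The identifier of a node as a bit string of length `2 * d`. -/
def labelBits (d n j : ℕ) : List Bool :=
  (nodeLabel d n j).flatMap symbolBits

/-- Extension by zero of a vector, used for padding to a length that is a power of two. -/
def padded {F : Type*} [Zero F] {L : ℕ} (x : Fin L → F) (j : ℕ) : F :=
  if h : j < L then x ⟨j, h⟩ else 0

/-- The depth of the tree for vectors of length `L`: the least `d` with `L ≤ 2 ^ d`. -/
def treeDepth (L : ℕ) : ℕ := Nat.clog 2 L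

/-- The hash at the leaf `j`, namely `H (leaf j ‖ v j ‖ r j)`, where `enc` represents field
elements as bit strings of a fixed length. -/
def leafHash {κ ℓ L : ℕ} {F : Type*} [Zero F] (H : Oracle κ) (enc : F → Fin ℓ → Bool)
    (v r : Fin L → F) (j : ℕ) : Digest κ :=
  H (labelBits (treeDepth L) 0 j ++ List.ofFn (enc (padded v j)) ++ List.ofFn (enc (padded r j)))

/-- The hash at the node of height `n` and position `j`; at an interior node `b` with the children
`b_L` and `b_R` it is `H (b ‖ h b_L ‖ h b_R)`. -/
def nodeHash {κ ℓ L : ℕ} {F : Type*} [Zero F] (H : Oracle κ) (enc : F → Fin ℓ → Bool)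
    (v r : Fin L → F) : ℕ → ℕ → Digest κ
  | 0, j => leafHash H enc v r j
  | n + 1, j =>
      H (labelBits (treeDepth L) (n + 1) j ++
        List.ofFn (nodeHash H enc v r n (2 * j)) ++
        List.ofFn (nodeHash H enc v r n (2 * j + 1)))

/-- The commitment to `v` with randomness `r`: the hash at the root. -/
def merkleCommit {κ ℓ L : ℕ} {F : Type*} [Zero F] (H : Oracle κ) (enc : F → Fin ℓ → Bool)
    (v r : Fin L → F) : Digest κ :=
  nodeHash H enc v r (treeDepth L) 0

/-- Merkle paths: one hash for each height below the root. -/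
abbrev Witness (κ L : ℕ) : Type := Fin (treeDepth L) → Digest κ

/-- The witness for the position `i`: the hashes at the siblings of the nodes on the path from the
leaf `i` to the root. The node of height `n` on that path has position `i / 2 ^ n`, and the
position of its sibling differs from this in the last bit. -/
def merkleOpen {κ ℓ L : ℕ} {F : Type*} [Zero F] (H : Oracle κ) (enc : F → Fin ℓ → Bool)
    (v r : Fin L → F) (i : Fin L) : Witness κ L :=
  fun n => nodeHash H enc v r n (((i : ℕ) / 2 ^ (n : ℕ)) ^^^ 1)

/-! ### Adversaries

An adversary is an arbitrary adaptive strategy. The actions it can take are: tossing a coin,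
querying the random oracle, interacting with the challenger, and giving its output; the next action
depends in an arbitrary way on all that it has seen. No bound is put on what it computes between
two actions, and there may be a different strategy for every `κ`. -/

/-- What an adversary does after it has received the commitment. -/
inductive Guesser (κ : ℕ) (F : Type*) (N : ℕ)
  /-- output the guess `b` -/
  | guess (b : Bool)
  /-- toss a coin -/
  | toss (next : Bool → Guesser κ F N)
  /-- query the random oracle at `x` -/
  | hash (x : List Bool) (next : Digest κ → Guesser κ F N)
  /-- ask for the opening at position `i`; the reply `none` is a refusal -/
  | openAt (i : Fin N) (next : Option (F × Witness κ N) → Guesser κ F N)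

/-- What an adversary does from the beginning. -/
inductive Adversary (κ : ℕ) (F : Type*) (N : ℕ)
  /-- provide the two challenge vectors, and continue when given the commitment -/
  | challenge (v₀ v₁ : Fin N → F) (next : Digest κ → Guesser κ F N)
  /-- toss a coin -/
  | toss (next : Bool → Adversary κ F N)
  /-- query the random oracle at `x` -/
  | hash (x : List Bool) (next : Digest κ → Adversary κ F N)

/-- On every branch, at most `q` queries to the random oracle are made. -/
def Guesser.QueriesAtMost {κ : ℕ} {F : Type*} {N : ℕ} : Guesser κ F N → ℕ → Prop
  | .guess _, _ => True
  | .toss next, q => ∀ c, (next c).QueriesAtMost q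
  | .hash _ next, q => 0 < q ∧ ∀ y, (next y).QueriesAtMost (q - 1)
  | .openAt _ next, q => ∀ a, (next a).QueriesAtMost q

/-- On every branch, at most `q` queries to the random oracle are made in total. -/
def Adversary.QueriesAtMost {κ : ℕ} {F : Type*} {N : ℕ} : Adversary κ F N → ℕ → Prop
  | .challenge _ _ next, q => ∀ C, (next C).QueriesAtMost q
  | .toss next, q => ∀ c, (next c).QueriesAtMost q
  | .hash _ next, q => 0 < q ∧ ∀ y, (next y).QueriesAtMost (q - 1)

/-! ### The hiding game -/

open Classical in
/-- The guess made after the commitment has been received, when `v` with randomness `r` has been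
committed to and the coins still to be tossed are `coins`. The set `Q` holds the positions opened
so far. The position `i` is opened only if the challenge vectors agree there, `i` has not been
opened before, and fewer than `T` positions have been opened. -/
noncomputable def Guesser.run {κ ℓ N : ℕ} {F : Type*} [Zero F] (H : Oracle κ)
    (enc : F → Fin ℓ → Bool) (T : ℕ) (v₀ v₁ v r : Fin N → F) :
    Guesser κ F N → (coins : ℕ → Bool) → (Q : Finset (Fin N)) → Bool
  | .guess b, _, _ => b
  | .toss next, coins, Q =>
      (next (coins 0)).run H enc T v₀ v₁ v r (fun n => coins (n + 1)) Q
  | .hash x next, coins, Q => (next (H x)).run H enc T v₀ v₁ v r coins Q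
  | .openAt i next, coins, Q =>
      if v₀ i = v₁ i ∧ i ∉ Q ∧ Q.card < T then
        (next (some (r i, merkleOpen H enc v r i))).run H enc T v₀ v₁ v r coins (insert i Q)
      else
        (next none).run H enc T v₀ v₁ v r coins Q

/-- The guess that the adversary makes in the game with oracle `H`, challenge bit `b` (`false`
selects the first challenge vector), commitment randomness `r` and coins `coins`. -/
noncomputable def Adversary.run {κ ℓ N : ℕ} {F : Type*} [Zero F] (H : Oracle κ)
    (enc : F → Fin ℓ → Bool) (T : ℕ) (b : Bool) (r : Fin N → F) :
    Adversary κ F N → (coins : ℕ → Bool) → Bool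
  | .challenge v₀ v₁ next, coins =>
      (next (merkleCommit H enc (if b then v₁ else v₀) r)).run H enc T v₀ v₁
        (if b then v₁ else v₀) r coins ∅
  | .toss next, coins => (next (coins 0)).run H enc T b r (fun n => coins (n + 1))
  | .hash x next, coins => (next (H x)).run H enc T b r coins

/-- The probability that the adversary guesses the challenge bit. The oracle `H`, the coins of the
adversary, the challenge bit `b`, the message `m ∈ Fᴷ` and the randomness `s ∈ Fᵀ` are independent
and uniform, and the commitment randomness is the encoding of `m` with randomness `s`. -/
noncomputable def successProbability {κ ℓ N : ℕ} {F : Type*} [Field F] [Fintype F] (K T : ℕ)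
    (α : Fin N → F) (enc : F → Fin ℓ → Bool) (A : Adversary κ F N) : ℝ :=
  letI : MeasurableSpace F := ⊤
  ((randomOracle κ).prod (coinTosses.prod ((uniformMeasure Bool).prod
      ((uniformMeasure (Fin K → F)).prod (uniformMeasure (Fin T → F)))))).real
    {ω : Oracle κ × (ℕ → Bool) × Bool × (Fin K → F) × (Fin T → F) |
      A.run ω.1 enc T ω.2.2.1 (heccEncode α ω.2.2.2.1 ω.2.2.2.2) ω.2.1 = ω.2.2.1}

/-!
If the oracle is programmed to answer the inputs of the leaves with fresh independent digests, it is
still a random oracle, and the tree no longer depends on the vector committed to. In the ideal game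
the challenger shows a tree over such digests, but the oracle is programmed only at the leaves
already opened; there the two challenge vectors agree, so that the ideal game does not depend on the
challenge bit at all. It differs from the game only once the adversary queries an input with the
salt of an unopened leaf. Any `K + T` coordinates of a codeword are independent and uniform and at
most `T < K + T` of them are shown, so that each salt still hidden is uniform given those shown. A
string determines one leaf and one salt, hence a query hits with probability at most `1 / |F|`.

With `q` queries the ideal guess is therefore defined with probability at least `1 - q / |F|`, and
is then right and wrong with equal probability. The guess in the game is right, and likewise wrong,
with probability at least `(1 - q / |F|) / 2`, which bounds the advantage by `q / (2 |F|)`.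
-/

open scoped ENNReal

/-! ### Inputs of the random oracle -/

theorem flatMap_symbolBits_injective :
    Function.Injective fun l : List (Option Bool) => l.flatMap symbolBits := by
  intro l
  induction l with
  | nil => rintro (_ | ⟨_ | b, l'⟩) h <;> simp_all [symbolBits]
  | cons a l ih =>
    rintro (_ | ⟨a', l'⟩) h
    · rcases a with _ | b <;> simp [symbolBits] at h
    have symbolBits_length (s : Option Bool) : (symbolBits s).length = 2 := by
      cases s <;> rfl
    obtain ⟨hhead, htail⟩ := List.append_inj
      (show symbolBits a ++ l.flatMap symbolBits = symbolBits a' ++ l'.flatMap symbolBits from h)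
      (by rw [symbolBits_length, symbolBits_length])
    have ha : a = a' := by
      rcases a with _ | b <;> rcases a' with _ | b' <;> simp_all [symbolBits]
    rw [ha, ih htail]

theorem labelBits_length {d n : ℕ} (hn : n ≤ d) (j : ℕ) : (labelBits d n j).length = 2 * d := by
  have flatMap_length (l : List (Option Bool)) : (l.flatMap symbolBits).length = 2 * l.length := by
    induction l with
    | nil => rfl
    | cons a l ih => rcases a with _ | b <;> simp [symbolBits, ih] <;> ring
  simp [labelBits, flatMap_length, nodeLabel]
  omega

theorem eq_of_labelBits_zero_eq {d i j : ℕ} (hi : i < 2 ^ d) (hj : j < 2 ^ d)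
    (h : labelBits d 0 i = labelBits d 0 j) : i = j := by
  have hdigits : ∀ t < d, i.testBit (d - 1 - t) = j.testBit (d - 1 - t) := by
    simpa [nodeLabel] using flatMap_symbolBits_injective h
  refine Nat.eq_of_testBit_eq fun t => ?_
  rcases lt_or_ge t d with ht | ht
  · simpa [show d - 1 - (d - 1 - t) = t by omega] using hdigits (d - 1 - t) (by omega)
  · have hpow : 2 ^ d ≤ 2 ^ t := Nat.pow_le_pow_right two_pos ht
    rw [Nat.testBit_lt_two_pow (hi.trans_le hpow), Nat.testBit_lt_two_pow (hj.trans_le hpow)]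

theorem labelBits_succ_ne_labelBits_zero (d n i j : ℕ) :
    labelBits d (n + 1) i ≠ labelBits d 0 j := by
  intro h
  have hstar : (none : Option Bool) ∈ nodeLabel d (n + 1) i := by simp [nodeLabel]
  rw [flatMap_symbolBits_injective h] at hstar
  simp [nodeLabel] at hstar

/-- The input that is hashed at the leaf `j` of the tree for vectors of length `L`, when the value
there is `a` and the salt is `g`. -/
def leafInput {ℓ : ℕ} {F : Type*} (L : ℕ) (enc : F → Fin ℓ → Bool) (j : ℕ) (a g : F) : List Bool :=
  labelBits (treeDepth L) 0 j ++ List.ofFn (enc a) ++ List.ofFn (enc g)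

section LeafInput

variable {ℓ L : ℕ} {F : Type*} {enc : F → Fin ℓ → Bool} {i j : ℕ} {a a' g g' : F}

theorem lt_two_pow_treeDepth (i : Fin L) : (i : ℕ) < 2 ^ treeDepth L :=
  i.2.trans_le (Nat.le_pow_clog one_lt_two L)

theorem index_eq_of_leafInput_eq (hi : i < 2 ^ treeDepth L) (hj : j < 2 ^ treeDepth L)
    (h : leafInput L enc i a g = leafInput L enc j a' g') : i = j := by
  rw [leafInput, leafInput, List.append_assoc, List.append_assoc] at h
  exact eq_of_labelBits_zero_eq hi hj
    (List.append_inj_left h (by simp [labelBits_length]))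

theorem salt_eq_of_leafInput_eq (henc : Function.Injective enc)
    (h : leafInput L enc i a g = leafInput L enc j a' g') : g = g' :=
  henc (List.ofFn_injective (List.append_inj_right h (by simp [labelBits_length])))

theorem leafInput_ne_of_labelBits_succ {n : ℕ} (hn : n < treeDepth L) (l : List Bool) :
    leafInput L enc i a g ≠ labelBits (treeDepth L) (n + 1) j ++ l := by
  rw [leafInput, List.append_assoc]
  intro h
  exact labelBits_succ_ne_labelBits_zero _ _ _ _
    (List.append_inj_left h (by simp [labelBits_length, Nat.succ_le_of_lt hn])).symm

theorem injective_leafInput (enc : F → Fin ℓ → Bool) (v r : Fin L → F) :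
    Function.Injective fun i : Fin L => leafInput L enc i (v i) (r i) := fun _ _ h =>
  Fin.ext (index_eq_of_leafInput_eq (lt_two_pow_treeDepth _) (lt_two_pow_treeDepth _) h)

end LeafInput

/-! ### Programming the oracle at the leaves -/

/-- The oracle that answers the input of each leaf in `Q`, for the values `v` and the salts `r`,
with the digest of that leaf in `y`, and all other inputs like `H`. -/
noncomputable def programOracle {κ ℓ N : ℕ} {F : Type*} (H : Oracle κ) (enc : F → Fin ℓ → Bool)
    (v r : Fin N → F) (Q : Finset (Fin N)) (y : Fin N → Digest κ) : Oracle κ :=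
  Function.extend (fun i : Q => leafInput N enc (i : Fin N) (v i) (r i)) (fun i : Q => y i) H

/-- The oracle used by the challenger of the ideal game. With it the tree of the zero vectors has
the hashes `y` at its leaves, and it stands for the tree of any vectors. -/
noncomputable def idealOracle {κ ℓ N : ℕ} {F : Type*} [Zero F] (H : Oracle κ)
    (enc : F → Fin ℓ → Bool) (y : Fin N → Digest κ) : Oracle κ :=
  programOracle H enc 0 0 Finset.univ y

/-- The string `x` is an input with the salt of a leaf outside `Q`. -/
def HitsSalt {ℓ N : ℕ} {F : Type*} (enc : F → Fin ℓ → Bool) (r : Fin N → F) (Q : Finset (Fin N))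
    (x : List Bool) : Prop :=
  ∃ i ∉ Q, ∃ a, x = leafInput N enc (i : Fin N) a (r i)

section ProgramOracle

variable {κ ℓ N : ℕ} {F : Type*} {enc : F → Fin ℓ → Bool} {v v' r r' : Fin N → F}
  {Q : Finset (Fin N)} {H : Oracle κ} {y : Fin N → Digest κ} {x : List Bool}

theorem programOracle_leafInput {i : Fin N} (hi : i ∈ Q) :
    programOracle H enc v r Q y (leafInput N enc i (v i) (r i)) = y i :=
  ((injective_leafInput enc v r).comp Subtype.val_injective).extend_apply _ _ (⟨i, hi⟩ : Q)

theorem programOracle_of_forall_ne (h : ∀ i ∈ Q, leafInput N enc i (v i) (r i) ≠ x) :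
    programOracle H enc v r Q y x = H x :=
  Function.extend_apply' _ _ _ fun ⟨i, hi⟩ => h i i.2 hi

theorem programOracle_empty : programOracle H enc v r ∅ y = H :=
  funext fun _ => programOracle_of_forall_ne (by simp)

theorem programOracle_congr (hv : ∀ i ∈ Q, v i = v' i) (hr : ∀ i ∈ Q, r i = r' i) :
    programOracle H enc v r Q y = programOracle H enc v' r' Q y := by
  have hinput : (fun i : Q => leafInput N enc (i : Fin N) (v i) (r i)) =
      fun i : Q => leafInput N enc (i : Fin N) (v' i) (r' i) :=
    funext fun i => by rw [hv i i.2, hr i i.2]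
  rw [programOracle, programOracle, hinput]

theorem programOracle_univ_of_not_hitsSalt (h : ¬ HitsSalt enc r Q x) :
    programOracle H enc v r Finset.univ y x = programOracle H enc v r Q y x := by
  by_cases hx : ∃ i : Fin N, leafInput N enc i (v i) (r i) = x
  · obtain ⟨i, rfl⟩ := hx
    have hi : i ∈ Q := by
      by_contra hi
      exact h ⟨i, hi, v i, rfl⟩
    rw [programOracle_leafInput hi, programOracle_leafInput (Finset.mem_univ i)]
  · push Not at hx
    rw [programOracle_of_forall_ne fun i _ => hx i, programOracle_of_forall_ne fun i _ => hx i]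

theorem nodeHash_programOracle_univ [Zero F] {n j : ℕ} (hn : n ≤ treeDepth N)
    (hj : j < 2 ^ (treeDepth N - n)) :
    nodeHash (programOracle H enc v r Finset.univ y) enc v r n j =
      nodeHash (L := N) (idealOracle H enc y) enc 0 0 n j := by
  induction n generalizing j with
  | zero =>
    have leafHash_eq (H' : Oracle κ) (w s : Fin N → F) :
        nodeHash H' enc w s 0 j = H' (leafInput N enc j (padded w j) (padded s j)) := rfl
    rw [leafHash_eq, leafHash_eq]
    by_cases hjN : j < N
    · simp only [padded, hjN, dite_true]
      exact (programOracle_leafInput (i := ⟨j, hjN⟩) (Finset.mem_univ _)).trans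
        (programOracle_leafInput (i := ⟨j, hjN⟩) (Finset.mem_univ _)).symm
    · simp only [padded, hjN, dite_false]
      have hne (w s : Fin N → F) (i : Fin N) :
          leafInput N enc i (w i) (s i) ≠ leafInput N enc j 0 0 := fun h =>
        hjN (index_eq_of_leafInput_eq (lt_two_pow_treeDepth i) hj h ▸ i.2)
      exact (programOracle_of_forall_ne fun i _ => hne v r i).trans
        (programOracle_of_forall_ne fun i _ => hne 0 0 i).symm
  | succ n ih =>
    have hpow : 2 ^ (treeDepth N - n) = 2 * 2 ^ (treeDepth N - (n + 1)) := by
      rw [← pow_succ']; congr 1; omega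
    have hinterior (w s : Fin N → F) (l : List Bool) :
        programOracle H enc w s Finset.univ y (labelBits (treeDepth N) (n + 1) j ++ l) =
          H (labelBits (treeDepth N) (n + 1) j ++ l) :=
      programOracle_of_forall_ne fun i _ => leafInput_ne_of_labelBits_succ hn l
    rw [nodeHash, nodeHash, ih (by omega) (by omega), ih (by omega) (by omega), List.append_assoc,
      hinterior, idealOracle, hinterior]

theorem merkleCommit_programOracle_univ [Zero F] :
    merkleCommit (programOracle H enc v r Finset.univ y) enc v r =
      merkleCommit (L := N) (idealOracle H enc y) enc 0 0 :=
  nodeHash_programOracle_univ le_rfl (by positivity)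

theorem merkleOpen_programOracle_univ [Zero F] (i : Fin N) :
    merkleOpen (programOracle H enc v r Finset.univ y) enc v r i =
      merkleOpen (idealOracle H enc y) enc 0 0 i := by
  funext n
  have hn := n.2
  have hancestor : (i : ℕ) / 2 ^ (n : ℕ) < 2 ^ (treeDepth N - n) := by
    rw [Nat.div_lt_iff_lt_mul (by positivity), ← pow_add, Nat.sub_add_cancel hn.le]
    exact lt_two_pow_treeDepth i
  exact nodeHash_programOracle_univ hn.le
    (Nat.xor_lt_two_pow hancestor (Nat.one_lt_two_pow (by omega)))

end ProgramOracle

/-! ### The ideal game -/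

open Classical in
/-- The guess in the ideal game after the commitment has been received, when the leaves in `Q`
have been opened. The challenger shows the tree with the hashes `y` at its leaves, and the oracle
is programmed at the opened leaves only. The value `none` means that the adversary has queried an
input with the salt of a leaf that was not opened. -/
noncomputable def Guesser.idealRun {κ ℓ N : ℕ} {F : Type*} [Zero F] (H : Oracle κ)
    (enc : F → Fin ℓ → Bool) (T : ℕ) (y : Fin N → Digest κ) (v₀ v₁ r : Fin N → F) :
    Guesser κ F N → (coins : ℕ → Bool) → (Q : Finset (Fin N)) → Option Bool
  | .guess b, _, _ => some b
  | .toss next, coins, Q =>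
      (next (coins 0)).idealRun H enc T y v₀ v₁ r (fun n => coins (n + 1)) Q
  | .hash x next, coins, Q =>
      if HitsSalt enc r Q x then none
      else (next (programOracle H enc v₀ r Q y x)).idealRun H enc T y v₀ v₁ r coins Q
  | .openAt i next, coins, Q =>
      if v₀ i = v₁ i ∧ i ∉ Q ∧ Q.card < T then
        (next (some (r i, merkleOpen (idealOracle H enc y) enc 0 0 i))).idealRun H enc T y v₀ v₁ r
          coins (insert i Q)
      else
        (next none).idealRun H enc T y v₀ v₁ r coins Q

open Classical in
/-- The guess in the ideal game, in which nothing depends on the challenge bit. The value `none`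
means that the adversary has queried an input with the salt of a leaf that was not opened. -/
noncomputable def Adversary.idealRun {κ ℓ N : ℕ} {F : Type*} [Zero F] (H : Oracle κ)
    (enc : F → Fin ℓ → Bool) (T : ℕ) (y : Fin N → Digest κ) (r : Fin N → F) :
    Adversary κ F N → (coins : ℕ → Bool) → Option Bool
  | .challenge v₀ v₁ next, coins =>
      (next (merkleCommit (L := N) (idealOracle H enc y) enc 0 0)).idealRun H enc T y v₀ v₁ r
        coins ∅
  | .toss next, coins => (next (coins 0)).idealRun H enc T y r (fun n => coins (n + 1))
  | .hash x next, coins =>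
      if HitsSalt enc r ∅ x then none else (next (H x)).idealRun H enc T y r coins

/-- The vector that is committed to in the game with oracle `H` and challenge bit `b`. -/
def Adversary.committed {κ N : ℕ} {F : Type*} (H : Oracle κ) (b : Bool) :
    Adversary κ F N → (coins : ℕ → Bool) → Fin N → F
  | .challenge v₀ v₁ _, _ => if b then v₁ else v₀
  | .toss next, coins => (next (coins 0)).committed H b (fun n => coins (n + 1))
  | .hash x next, coins => (next (H x)).committed H b coins

section RunProgramOracle

variable {κ ℓ N T : ℕ} {F : Type*} [Zero F] {enc : F → Fin ℓ → Bool} {H : Oracle κ}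
  {y : Fin N → Digest κ} {v r : Fin N → F} {coins : ℕ → Bool} {b : Bool}

theorem Guesser.run_programOracle_univ {v₀ v₁ : Fin N → F} (hv : ∀ i, v₀ i = v₁ i → v i = v₀ i)
    {g : Guesser κ F N} {Q : Finset (Fin N)} (hQ : ∀ i ∈ Q, v₀ i = v₁ i)
    (h : g.idealRun H enc T y v₀ v₁ r coins Q = some b) :
    g.run (programOracle H enc v r Finset.univ y) enc T v₀ v₁ v r coins Q = b := by
  induction g generalizing coins Q with
  | guess b' => simpa [Guesser.idealRun, Guesser.run] using h
  | toss next ih => exact ih _ hQ h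
  | hash x next ih =>
    rw [Guesser.idealRun] at h
    split_ifs at h with hx
    rw [Guesser.run, programOracle_univ_of_not_hitsSalt hx,
      programOracle_congr (fun i hi => hv i (hQ i hi)) fun _ _ => rfl]
    exact ih _ hQ h
  | openAt i next ih =>
    rw [Guesser.idealRun] at h
    rw [Guesser.run]
    split_ifs at h ⊢ with hi
    · rw [merkleOpen_programOracle_univ]
      exact ih _ (Finset.forall_mem_insert _ _ _ |>.2 ⟨hi.1, hQ⟩) h
    · exact ih _ hQ h

theorem Adversary.run_programOracle_univ {c : Bool} {A : Adversary κ F N}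
    (h : A.idealRun H enc T y r coins = some b) (hv : A.committed H c coins = v) :
    A.run (programOracle H enc v r Finset.univ y) enc T c r coins = b ∧
      A.committed (programOracle H enc v r Finset.univ y) c coins = v := by
  induction A generalizing coins with
  | challenge v₀ v₁ next =>
    refine ⟨?_, hv⟩
    rw [Adversary.committed] at hv
    rw [Adversary.run, hv, merkleCommit_programOracle_univ]
    refine Guesser.run_programOracle_univ (fun i hi => ?_) (by simp) h
    rw [← hv]
    split_ifs
    exacts [hi.symm, rfl]
  | toss next ih => exact ih _ h hv
  | hash x next ih =>
    rw [Adversary.idealRun] at h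
    split_ifs at h with hx
    have hx' : programOracle H enc v r Finset.univ y x = H x := by
      rw [programOracle_univ_of_not_hitsSalt hx, programOracle_empty]
    rw [Adversary.run, Adversary.committed, hx']
    exact ih _ h hv

end RunProgramOracle

/-! ### Measure-theoretic preliminaries -/

instance (α : Type*) [Fintype α] [Nonempty α] [MeasurableSpace α] :
    IsProbabilityMeasure (uniformMeasure α) :=
  PMF.toMeasure.isProbabilityMeasure _

instance (κ : ℕ) : IsProbabilityMeasure (randomOracle κ) :=
  inferInstanceAs (IsProbabilityMeasure (Measure.infinitePi _))

instance : IsProbabilityMeasure coinTosses :=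
  inferInstanceAs (IsProbabilityMeasure (Measure.infinitePi _))

theorem uniformMeasure_singleton {α : Type*} [Fintype α] [Nonempty α] [MeasurableSpace α]
    [MeasurableSingletonClass α] (a : α) :
    uniformMeasure α {a} = (Fintype.card α : ℝ≥0∞)⁻¹ := by
  rw [uniformMeasure, PMF.toMeasure_apply_singleton _ _ (measurableSet_singleton a),
    PMF.uniformOfFintype_apply]

theorem uniformMeasure_prod (α β : Type*) [Fintype α] [Nonempty α] [MeasurableSpace α]
    [MeasurableSingletonClass α] [Fintype β] [Nonempty β] [MeasurableSpace β]
    [MeasurableSingletonClass β] :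
    (uniformMeasure α).prod (uniformMeasure β) = uniformMeasure (α × β) := by
  refine Measure.ext_of_singleton fun p => ?_
  rw [← Set.singleton_prod_singleton, Measure.prod_prod, uniformMeasure_singleton,
    uniformMeasure_singleton, Set.singleton_prod_singleton, uniformMeasure_singleton,
    Fintype.card_prod, Nat.cast_mul, ENNReal.mul_inv (by simp) (by simp)]

theorem measurable_extend {ι X D : Type*} [MeasurableSpace D] {e : ι → X}
    (he : Function.Injective e) :
    Measurable fun p : (X → D) × (ι → D) => Function.extend e p.2 p.1 := by
  refine measurable_pi_lambda _ fun x => ?_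
  by_cases hx : ∃ i, e i = x
  · obtain ⟨i, rfl⟩ := hx
    simp only [he.extend_apply]
    fun_prop
  · simp only [Function.extend_apply' _ _ _ hx]
    fun_prop

theorem measurePreserving_extend {ι X D : Type*} [MeasurableSpace D] {e : ι → X}
    (he : Function.Injective e) (μ : X → Measure D) [∀ x, IsProbabilityMeasure (μ x)] :
    MeasurePreserving (fun p : (X → D) × (ι → D) => Function.extend e p.2 p.1)
      ((Measure.infinitePi μ).prod (Measure.infinitePi fun i => μ (e i)))
      (Measure.infinitePi μ) := by
  classical
  refine ⟨measurable_extend he, Measure.eq_infinitePi _ fun s t ht => ?_⟩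
  have hbox : (fun p : (X → D) × (ι → D) => Function.extend e p.2 p.1) ⁻¹' Set.pi s t =
      Set.pi (s.filter (· ∉ Set.range e)) t ×ˢ
        Set.pi (s.preimage e he.injOn) fun i => t (e i) := by
    ext p
    simp only [Set.mem_preimage, Set.mem_pi, Set.mem_prod, Finset.mem_coe, Finset.mem_filter,
      Finset.mem_preimage]
    constructor
    · refine fun h => ⟨fun x hx => ?_, fun i hi => ?_⟩
      · simpa only [Function.extend_apply' _ _ _ hx.2] using h x hx.1
      · simpa only [he.extend_apply] using h (e i) hi
    · rintro ⟨hout, hin⟩ x hx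
      by_cases hxe : x ∈ Set.range e
      · obtain ⟨i, rfl⟩ := hxe
        simpa only [he.extend_apply] using hin i hx
      · simpa only [Function.extend_apply' _ _ _ hxe] using hout x ⟨hx, hxe⟩
  rw [Measure.map_apply (measurable_extend he)
      (MeasurableSet.pi s.countable_toSet fun x _ => ht x), hbox, Measure.prod_prod,
    Measure.infinitePi_pi _ fun x _ => ht x, Measure.infinitePi_pi _ fun i _ => ht (e i),
    Finset.prod_preimage' e s he.injOn fun x => μ x (t x), mul_comm,
    Finset.prod_filter_mul_prod_filter_not]

theorem le_prod_of_forall_le {α β : Type*} [MeasurableSpace α] [MeasurableSpace β]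
    (μ : Measure α) [IsProbabilityMeasure μ] (ν : Measure β) [SFinite ν] {s : Set (α × β)}
    {c : ℝ≥0∞} (h : ∀ a, c ≤ ν (Prod.mk a ⁻¹' s)) : c ≤ μ.prod ν s := by
  calc
    c = ∫⁻ _, c ∂μ := by simp
    _ ≤ ∫⁻ a, ν (Prod.mk a ⁻¹' toMeasurable (μ.prod ν) s) ∂μ :=
      lintegral_mono fun a =>
        (h a).trans (measure_mono (Set.preimage_mono (subset_toMeasurable _ s)))
    _ = μ.prod ν (toMeasurable (μ.prod ν) s) :=
      (Measure.prod_apply (measurableSet_toMeasurable _ _)).symm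
    _ = μ.prod ν s := measure_toMeasurable s

theorem measure_le_of_forall_fiber_le {α β ι : Type*} [MeasurableSpace α] [MeasurableSpace β]
    [Countable ι] {μ : Measure α} {ν : Measure β} {s : Set α} {t : Set β} {f : α → ι} {g : β → ι}
    (ht : ∀ i, MeasurableSet (t ∩ g ⁻¹' {i}))
    (h : ∀ i, μ (s ∩ f ⁻¹' {i}) ≤ ν (t ∩ g ⁻¹' {i})) : μ s ≤ ν t := by
  have hs : s = ⋃ i, s ∩ f ⁻¹' {i} := by ext; simp
  have ht' : t = ⋃ i, t ∩ g ⁻¹' {i} := by ext; simp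
  rw [hs, ht', measure_iUnion (fun i j hij => ?_) ht]
  · exact (measure_iUnion_le _).trans (ENNReal.tsum_le_tsum h)
  · exact Set.disjoint_left.2 fun b hi hj => hij (hi.2.symm.trans hj.2)

theorem prod_uniformMeasure_bool_eq_some {Ω : Type*} [Countable Ω] [MeasurableSpace Ω]
    [DiscreteMeasurableSpace Ω] (ν : Measure Ω) [SFinite ν] (f : Ω → Option Bool)
    (x : Equiv.Perm Bool) :
    (uniformMeasure Bool).prod ν {w | f w.2 = some (x w.1)} = ν {ω | f ω ≠ none} / 2 := by
  have hsome : {ω | f ω ≠ none} = {ω | f ω = some true} ∪ {ω | f ω = some false} := by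
    ext ω
    rcases h : f ω with _ | _ | _ <;> simp [h]
  have hdisj : Disjoint {ω | f ω = some true} {ω | f ω = some false} :=
    Set.disjoint_left.2 fun ω h h' => by simp_all
  calc
    (uniformMeasure Bool).prod ν {w | f w.2 = some (x w.1)}
      = ∑ b, ν {ω | f ω = some (x b)} * 2⁻¹ := by
        rw [Measure.prod_apply .of_discrete, lintegral_fintype]
        simp [uniformMeasure_singleton]
    _ = ∑ b, ν {ω | f ω = some b} * 2⁻¹ :=
        Equiv.sum_comp x fun b => ν {ω | f ω = some b} * 2⁻¹
    _ = ν {ω | f ω ≠ none} / 2 := by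
        rw [hsome, measure_union hdisj .of_discrete, Fintype.sum_bool, div_eq_mul_inv, add_mul]

theorem abs_measureReal_sub_half_le {Ω : Type*} [MeasurableSpace Ω] {μ : Measure Ω}
    [IsProbabilityMeasure μ] {s : Set Ω} (hs : MeasurableSet s) {c : ℝ} (h : c ≤ μ.real s)
    (h' : c ≤ μ.real sᶜ) : |μ.real s - 1 / 2| ≤ 1 / 2 - c := by
  rw [probReal_compl_eq_one_sub hs] at h'
  rw [abs_le]
  constructor <;> linarith

/-! ### Querying the salt of an unopened leaf -/

/-- Under `μ` the coordinates of `r` at any `k` indices are independent and uniform. -/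
def IsWiseUniform {Ω ι F : Type*} [MeasurableSpace Ω] [Fintype F] (k : ℕ) (r : Ω → ι → F)
    (μ : Measure Ω) : Prop :=
  ∀ Q : Finset ι, Q.card ≤ k → ∀ c : ι → F,
    μ {ω | ∀ j ∈ Q, r ω j = c j} = (Fintype.card F : ℝ≥0∞)⁻¹ ^ Q.card

section WiseUniform

variable {Ω F : Type*} [MeasurableSpace Ω] [Fintype F] {μ : Measure Ω} {κ ℓ N T q : ℕ}
  {r : Ω → Fin N → F} {enc : F → Fin ℓ → Bool}

theorem IsWiseUniform.measure_hitsSalt_le {k : ℕ} (h : IsWiseUniform k r μ)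
    (henc : Function.Injective enc) {Q : Finset (Fin N)} (hQ : Q.card < k) (c : Fin N → F)
    (x : List Bool) :
    μ {ω | (∀ j ∈ Q, r ω j = c j) ∧ HitsSalt enc (r ω) Q x} ≤
      (Fintype.card F : ℝ≥0∞)⁻¹ ^ (Q.card + 1) := by
  by_cases hx : ∃ i ∉ Q, ∃ a g, x = leafInput N enc (i : Fin N) a g
  · obtain ⟨i, hi, a, g, rfl⟩ := hx
    rw [← Finset.card_insert_of_notMem hi,
      ← h (insert i Q) (by rwa [Finset.card_insert_of_notMem hi]) (Function.update c i g)]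
    refine measure_mono ?_
    rintro ω ⟨hc, i', hi', a', hinput⟩
    obtain rfl : i = i' := Fin.ext
      (index_eq_of_leafInput_eq (lt_two_pow_treeDepth i) (lt_two_pow_treeDepth i') hinput)
    refine Finset.forall_mem_insert _ _ _ |>.2 ⟨?_, fun j hj => ?_⟩
    · rw [Function.update_self, salt_eq_of_leafInput_eq henc hinput]
    · rw [Function.update_of_ne (ne_of_mem_of_not_mem hj hi), hc j hj]
  · have hempty : {ω | (∀ j ∈ Q, r ω j = c j) ∧ HitsSalt enc (r ω) Q x} = ∅ :=
      Set.eq_empty_of_forall_notMem fun ω ⟨_, i, hi, a, hinput⟩ => hx ⟨i, hi, a, r ω i, hinput⟩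
    simp [hempty]

theorem natCast_pred_mul_add {n : ℕ} (hn : 0 < n) (c : ℝ≥0∞) : c + (n - 1 : ℕ) * c = n * c := by
  obtain ⟨n, rfl⟩ := Nat.exists_eq_add_one.2 hn
  push_cast
  ring_nf

theorem measure_forall_mem_eq_and_le_of_insert {ι : Type*} [DecidableEq ι] {r : Ω → ι → F}
    {Q : Finset ι} {i : ι} (hi : i ∉ Q) (c : ι → F) {p : Ω → Prop} {b : ℝ≥0∞}
    (h : ∀ a, μ {ω | (∀ j ∈ insert i Q, r ω j = Function.update c i a j) ∧ p ω} ≤ b) :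
    μ {ω | (∀ j ∈ Q, r ω j = c j) ∧ p ω} ≤ Fintype.card F * b := by
  calc
    _ ≤ μ (⋃ a, {ω | (∀ j ∈ insert i Q, r ω j = Function.update c i a j) ∧ p ω}) := by
      refine measure_mono fun ω hω => Set.mem_iUnion.2 ⟨r ω i, ?_, hω.2⟩
      refine Finset.forall_mem_insert _ _ _ |>.2 ⟨by rw [Function.update_self], fun j hj => ?_⟩
      rw [Function.update_of_ne (ne_of_mem_of_not_mem hj hi), hω.1 j hj]
    _ ≤ ∑ _ : F, b := (measure_iUnion_fintype_le _ _).trans (Finset.sum_le_sum fun a _ => h a)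
    _ = Fintype.card F * b := by rw [Finset.sum_const, Finset.card_univ, nsmul_eq_mul]

variable [Zero F] (H : Oracle κ) (y : Fin N → Digest κ)

/-- After each opening the salts that remain hidden are still uniform given those shown, so the
bound is proved on every event that fixes the salts shown. -/
theorem Guesser.measure_idealRun_eq_none_le (h : IsWiseUniform (T + 1) r μ)
    (henc : Function.Injective enc) (v₀ v₁ : Fin N → F) {g : Guesser κ F N}
    (hg : g.QueriesAtMost q) (coins : ℕ → Bool) {Q : Finset (Fin N)} (hQ : Q.card ≤ T)
    (c : Fin N → F) :
    μ {ω | (∀ j ∈ Q, r ω j = c j) ∧ g.idealRun H enc T y v₀ v₁ (r ω) coins Q = none} ≤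
      q * (Fintype.card F : ℝ≥0∞)⁻¹ ^ (Q.card + 1) := by
  induction g generalizing q coins Q c with
  | guess b => simp [Guesser.idealRun]
  | toss next ih => exact ih _ (hg _) _ hQ c
  | hash x next ih =>
    rw [← natCast_pred_mul_add hg.1]
    refine (measure_mono ?_).trans ((measure_union_le _ _).trans
      (add_le_add (h.measure_hitsSalt_le henc (Nat.lt_succ_of_le hQ) c x)
        (ih (programOracle H enc v₀ c Q y x) (hg.2 _) coins hQ c)))
    rintro ω ⟨hc, hnone⟩
    by_cases hx : HitsSalt enc (r ω) Q x
    · exact .inl ⟨hc, hx⟩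
    · rw [Guesser.idealRun, if_neg hx, programOracle_congr (fun _ _ => rfl) hc] at hnone
      exact .inr ⟨hc, hnone⟩
  | openAt i next ih =>
    by_cases hi : v₀ i = v₁ i ∧ i ∉ Q ∧ Q.card < T
    · have hcard : (insert i Q).card = Q.card + 1 := Finset.card_insert_of_notMem hi.2.1
      have hcancel : (Fintype.card F : ℝ≥0∞) *
          (q * (Fintype.card F : ℝ≥0∞)⁻¹ ^ ((insert i Q).card + 1)) =
            q * (Fintype.card F : ℝ≥0∞)⁻¹ ^ (Q.card + 1) := by
        rw [hcard, pow_succ' _ (Q.card + 1), mul_left_comm, ← mul_assoc (Fintype.card F : ℝ≥0∞),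
          ENNReal.mul_inv_cancel (by simp) (ENNReal.natCast_ne_top _), one_mul]
      simp only [Guesser.idealRun, if_pos hi]
      rw [← hcancel]
      refine measure_forall_mem_eq_and_le_of_insert hi.2.1 c fun a => le_trans (measure_mono ?_)
        (ih (some (a, merkleOpen (idealOracle H enc y) enc 0 0 i)) (hg _) coins
          (hcard ▸ hi.2.2) (Function.update c i a))
      rintro ω ⟨hc, hnone⟩
      rw [hc i (Finset.mem_insert_self i Q), Function.update_self] at hnone
      exact ⟨hc, hnone⟩
    · simp only [Guesser.idealRun, if_neg hi]
      exact ih _ (hg _) coins hQ c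

theorem Adversary.measure_idealRun_eq_none_le (h : IsWiseUniform (T + 1) r μ)
    (henc : Function.Injective enc) {A : Adversary κ F N} (hA : A.QueriesAtMost q)
    (coins : ℕ → Bool) :
    μ {ω | A.idealRun H enc T y (r ω) coins = none} ≤ q * (Fintype.card F : ℝ≥0∞)⁻¹ := by
  induction A generalizing q coins with
  | challenge v₀ v₁ next =>
    simpa [Adversary.idealRun] using Guesser.measure_idealRun_eq_none_le H y h henc v₀ v₁
      (hA (merkleCommit (L := N) (idealOracle H enc y) enc 0 0)) coins (Q := ∅) (by simp) 0
  | toss next ih => exact ih _ (hA _) _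
  | hash x next ih =>
    have hhit : μ {ω | HitsSalt enc (r ω) ∅ x} ≤ (Fintype.card F : ℝ≥0∞)⁻¹ := by
      simpa using h.measure_hitsSalt_le henc (Q := ∅) (by simp) 0 x
    rw [← natCast_pred_mul_add hA.1]
    refine (measure_mono fun ω hnone => ?_).trans ((measure_union_le _ _).trans
      (add_le_add hhit (ih (H x) (hA.2 _) coins)))
    by_cases hx : HitsSalt enc (r ω) ∅ x
    · exact .inl hx
    · rw [Set.mem_ofPred_eq, Adversary.idealRun, if_neg hx] at hnone
      exact .inr hnone

end WiseUniform

/-! ### The salts of the code -/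

theorem uniformMeasure_fiber {G G' : Type*} [AddGroup G] [AddGroup G'] [Fintype G] [Fintype G']
    [MeasurableSpace G] [MeasurableSingletonClass G] (φ : G →+ G') (hφ : Function.Surjective φ)
    (x : G') : uniformMeasure G (φ ⁻¹' {x}) = (Fintype.card G' : ℝ≥0∞)⁻¹ := by
  classical
  have hfiber (x' : G') :
      uniformMeasure G (φ ⁻¹' {x'}) = uniformMeasure G (φ ⁻¹' {x}) := by
    rw [uniformMeasure, PMF.toMeasure_uniformOfFintype_apply _ (Set.toFinite _).measurableSet,
      PMF.toMeasure_uniformOfFintype_apply _ (Set.toFinite _).measurableSet]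
    congr 2
    simpa [Fintype.card_subtype] using AddMonoidHom.card_fiber_eq_of_mem_range φ (hφ x') (hφ x)
  have hsum : ∑ x', uniformMeasure G (φ ⁻¹' {x'}) = 1 := by
    rw [← measure_biUnion_finset, ← measure_univ (μ := uniformMeasure G)]
    · congr 1
      ext; simp
    · exact fun a _ b _ hab => Set.disjoint_left.2 fun g hg hg' => hab (hg.symm.trans hg')
    · exact fun _ _ => (Set.toFinite _).measurableSet
  rw [Finset.sum_congr rfl fun x' _ => hfiber x', Finset.sum_const, Finset.card_univ,
    nsmul_eq_mul, mul_comm] at hsum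
  exact ENNReal.eq_inv_of_mul_eq_one_left hsum

section Code

variable {F : Type*} [Field F] {N K T : ℕ}

theorem heccEncode_add (α : Fin N → F) (m m' : Fin K → F) (s s' : Fin T → F) :
    heccEncode α (m + m') (s + s') = heccEncode α m s + heccEncode α m' s' := by
  funext i
  simp only [heccEncode, heccPolynomial, Pi.add_apply, map_add, add_mul, Finset.sum_add_distrib,
    Polynomial.eval_add]
  ring

theorem exists_heccPolynomial_eq {P : Polynomial F} (hP : P.degree < (K + T : ℕ)) :
    ∃ (m : Fin K → F) (s : Fin T → F), heccPolynomial m s = P := by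
  refine ⟨fun k => P.coeff k, fun j => P.coeff (K + j), ?_⟩
  conv_rhs => rw [← P.sum_C_mul_X_pow_eq, ← Polynomial.sum_fin _ (by simp) hP, Fin.sum_univ_add]
  rfl

theorem exists_heccEncode_eq {α : Fin N → F} (hα : Function.Injective α) {Q : Finset (Fin N)}
    (hQ : Q.card ≤ K + T) (c : Fin N → F) :
    ∃ (m : Fin K → F) (s : Fin T → F), ∀ j ∈ Q, heccEncode α m s j = c j := by
  obtain ⟨m, s, hP⟩ := exists_heccPolynomial_eq (K := K) (T := T)
    ((Lagrange.degree_interpolate_lt c (s := Q) hα.injOn).trans_le (Nat.cast_le.2 hQ))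
  refine ⟨m, s, fun j hj => ?_⟩
  rw [heccEncode, hP, Lagrange.eval_interpolate_at_node c hα.injOn hj]

theorem isWiseUniform_heccEncode [Fintype F] [MeasurableSpace F] [MeasurableSingletonClass F]
    {α : Fin N → F} (hα : Function.Injective α) :
    IsWiseUniform (K + T) (fun ω : (Fin K → F) × (Fin T → F) => heccEncode α ω.1 ω.2)
      (uniformMeasure ((Fin K → F) × (Fin T → F))) := by
  classical
  intro Q hQ c
  let φ : (Fin K → F) × (Fin T → F) →+ (Q → F) :=
    AddMonoidHom.mk' (fun ω j => heccEncode α ω.1 ω.2 j) fun ω ω' =>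
      funext fun j => congrFun (heccEncode_add α ω.1 ω'.1 ω.2 ω'.2) j
  have hφ : Function.Surjective φ := fun x => by
    obtain ⟨m, s, h⟩ := exists_heccEncode_eq (K := K) (T := T) hα hQ
      fun j => if hj : j ∈ Q then x ⟨j, hj⟩ else 0
    exact ⟨(m, s), funext fun j => (h j j.2).trans (dif_pos j.2)⟩
  have hpre : {ω : (Fin K → F) × (Fin T → F) | ∀ j ∈ Q, heccEncode α ω.1 ω.2 j = c j} =
      φ ⁻¹' {fun j : Q => c j} := by
    ext ω
    simp [φ, funext_iff]
  rw [hpre, uniformMeasure_fiber φ hφ, Fintype.card_fun, Fintype.card_coe, Nat.cast_pow,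
    ENNReal.inv_pow]

end Code

/-! ### Measurability of the game -/

theorem measurable_apply_of_countable {Ω ι β : Type*} [MeasurableSpace Ω] [MeasurableSpace β]
    [Countable ι] [MeasurableSpace ι] [MeasurableSingletonClass ι] {f : ι → Ω → β}
    (hf : ∀ i, Measurable (f i)) {g : Ω → ι} (hg : Measurable g) :
    Measurable fun ω => f (g ω) ω :=
  (measurable_from_prod_countable_right (f := fun p : ι × Ω => f p.1 p.2) hf).comp
    (hg.prodMk measurable_id)

section MeasurableGame

variable {Ω F : Type*} [MeasurableSpace Ω] {κ ℓ N : ℕ} {H : Ω → Oracle κ}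
  {coins : Ω → ℕ → Bool} {b : Ω → Bool}

theorem measurable_nodeHash [Zero F] (hH : Measurable H) (enc : F → Fin ℓ → Bool)
    (v r : Fin N → F) (n j : ℕ) : Measurable fun ω => nodeHash (H ω) enc v r n j := by
  induction n generalizing j with
  | zero => exact (measurable_pi_apply (_ : List Bool)).comp hH
  | succ n ih =>
    exact measurable_apply_of_countable
      (f := fun (h : Digest κ × Digest κ) ω =>
        H ω (labelBits (treeDepth N) (n + 1) j ++ List.ofFn h.1 ++ List.ofFn h.2))
      (fun _ => (measurable_pi_apply _).comp hH) ((ih (2 * j)).prodMk (ih (2 * j + 1)))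

theorem Guesser.measurable_run [Zero F] (hH : Measurable H) (hcoins : Measurable coins)
    (enc : F → Fin ℓ → Bool) (T : ℕ) (v₀ v₁ v r : Fin N → F) (g : Guesser κ F N)
    (Q : Finset (Fin N)) :
    Measurable fun ω => g.run (H ω) enc T v₀ v₁ v r (coins ω) Q := by
  induction g generalizing coins Q with
  | guess c => exact measurable_const
  | toss next ih =>
    exact measurable_apply_of_countable
      (fun c => ih c (coins := fun ω n => coins ω (n + 1)) (by fun_prop) Q)
      ((measurable_pi_apply 0).comp hcoins)
  | hash x next ih =>
    exact measurable_apply_of_countable (fun d => ih d hcoins Q) ((measurable_pi_apply x).comp hH)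
  | openAt i next ih =>
    by_cases hi : v₀ i = v₁ i ∧ i ∉ Q ∧ Q.card < T
    · simp only [Guesser.run, if_pos hi]
      exact measurable_apply_of_countable (fun w => ih (some (r i, w)) hcoins (insert i Q))
        (measurable_pi_lambda _ fun n => measurable_nodeHash hH enc v r n _)
    · simp only [Guesser.run, if_neg hi]
      exact ih none hcoins Q

theorem Adversary.measurable_committed [MeasurableSpace F] (hH : Measurable H)
    (hcoins : Measurable coins) (hb : Measurable b) (A : Adversary κ F N) :
    Measurable fun ω => A.committed (H ω) (b ω) (coins ω) := by
  induction A generalizing coins with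
  | challenge v₀ v₁ _ =>
    exact (measurable_from_top (f := fun c : Bool => if c then v₁ else v₀)).comp hb
  | toss next ih =>
    exact measurable_apply_of_countable
      (fun c => ih c (coins := fun ω n => coins ω (n + 1)) (by fun_prop))
      ((measurable_pi_apply 0).comp hcoins)
  | hash x next ih =>
    exact measurable_apply_of_countable (fun d => ih d hcoins) ((measurable_pi_apply x).comp hH)

theorem Adversary.measurable_run [Zero F] [Countable F] [MeasurableSpace F]
    [MeasurableSingletonClass F] {r : Ω → Fin N → F} (hH : Measurable H)
    (hcoins : Measurable coins) (hb : Measurable b) (hr : Measurable r) (enc : F → Fin ℓ → Bool)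
    (T : ℕ) (A : Adversary κ F N) :
    Measurable fun ω => A.run (H ω) enc T (b ω) (r ω) (coins ω) := by
  induction A generalizing coins with
  | challenge v₀ v₁ next =>
    refine measurable_apply_of_countable (f := fun (c : Bool × (Fin N → F)) ω =>
      (next (merkleCommit (H ω) enc (if c.1 then v₁ else v₀) c.2)).run (H ω) enc T v₀ v₁
        (if c.1 then v₁ else v₀) c.2 (coins ω) ∅) (fun c => ?_) (hb.prodMk hr)
    exact measurable_apply_of_countable
      (fun C => (next C).measurable_run hH hcoins enc T v₀ v₁ _ c.2 ∅)
      (measurable_nodeHash hH enc _ c.2 _ _)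
  | toss next ih =>
    exact measurable_apply_of_countable
      (fun c => ih c (coins := fun ω n => coins ω (n + 1)) (by fun_prop))
      ((measurable_pi_apply 0).comp hcoins)
  | hash x next ih =>
    exact measurable_apply_of_countable (fun d => ih d hcoins) ((measurable_pi_apply x).comp hH)

end MeasurableGame

/-! ### From the ideal game to the game -/

/-- The law of independent uniform digests for `N` leaves. -/
noncomputable def leafDigests (κ N : ℕ) : Measure (Fin N → Digest κ) :=
  Measure.infinitePi fun _ : Fin N => uniformMeasure (Digest κ)

instance (κ N : ℕ) : IsProbabilityMeasure (leafDigests κ N) :=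
  inferInstanceAs (IsProbabilityMeasure (Measure.infinitePi _))

section Transfer

variable {κ ℓ N : ℕ} {F : Type*} {enc : F → Fin ℓ → Bool}

theorem programOracle_univ (H : Oracle κ) (enc : F → Fin ℓ → Bool) (v r : Fin N → F)
    (y : Fin N → Digest κ) :
    programOracle H enc v r Finset.univ y =
      Function.extend (fun i : Fin N => leafInput N enc i (v i) (r i)) y H := by
  funext x
  by_cases hx : ∃ i : Fin N, leafInput N enc i (v i) (r i) = x
  · obtain ⟨i, rfl⟩ := hx
    rw [programOracle_leafInput (Finset.mem_univ i), (injective_leafInput enc v r).extend_apply]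
  · rw [Function.extend_apply' _ _ _ hx,
      programOracle_of_forall_ne fun i _ hi => hx ⟨i, hi⟩]

theorem measurePreserving_programOracle_univ (enc : F → Fin ℓ → Bool) (v r : Fin N → F) :
    MeasurePreserving (fun p : Oracle κ × (Fin N → Digest κ) =>
        programOracle p.1 enc v r Finset.univ p.2)
      ((randomOracle κ).prod (leafDigests κ N)) (randomOracle κ) := by
  simp only [programOracle_univ]
  exact measurePreserving_extend (injective_leafInput enc v r) fun _ => uniformMeasure (Digest κ)

/-- The vector committed to and the salts determine which inputs are programmed, and the oracle
programmed at fixed inputs is again a random oracle. -/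
theorem measure_idealRun_le_measure_run [Zero F] [Countable F] [MeasurableSpace F]
    [MeasurableSingletonClass F] {Ω : Type*} [MeasurableSpace Ω] (μ : Measure Ω) [SFinite μ]
    {coins : Ω → ℕ → Bool} {b x : Ω → Bool} {r : Ω → Fin N → F} (hcoins : Measurable coins)
    (hb : Measurable b) (hr : Measurable r) (hx : Measurable x) (enc : F → Fin ℓ → Bool) (T : ℕ)
    (A : Adversary κ F N) :
    (((randomOracle κ).prod (leafDigests κ N)).prod μ)
        {ω | A.idealRun ω.1.1 enc T ω.1.2 (r ω.2) (coins ω.2) = some (x ω.2)} ≤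
      ((randomOracle κ).prod μ)
        {ω | A.run ω.1 enc T (b ω.2) (r ω.2) (coins ω.2) = x ω.2} := by
  have hrun : MeasurableSet {ω : Oracle κ × Ω |
      A.run ω.1 enc T (b ω.2) (r ω.2) (coins ω.2) = x ω.2} :=
    measurableSet_eq_fun (A.measurable_run (by fun_prop) (by fun_prop) (by fun_prop)
      (by fun_prop) enc T) (by fun_prop)
  have hlabel : Measurable fun ω : Oracle κ × Ω =>
      (A.committed ω.1 (b ω.2) (coins ω.2), r ω.2) :=
    (A.measurable_committed (by fun_prop) (by fun_prop) (by fun_prop)).prodMk (by fun_prop)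
  refine measure_le_of_forall_fiber_le
    (f := fun ω => (A.committed ω.1.1 (b ω.2) (coins ω.2), r ω.2))
    (g := fun ω => (A.committed ω.1 (b ω.2) (coins ω.2), r ω.2))
    (fun _ => hrun.inter (hlabel (measurableSet_singleton _))) fun ⟨v, s⟩ => ?_
  have hprogram := (measurePreserving_programOracle_univ (κ := κ) enc v s).prod (.id μ)
  rw [← hprogram.measure_preimage
    (hrun.inter (hlabel (measurableSet_singleton _))).nullMeasurableSet]
  refine measure_mono ?_
  rintro ω ⟨hideal, hfiber⟩
  obtain ⟨hv, rfl⟩ := Prod.ext_iff.1 hfiber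
  obtain ⟨hrun, hcommitted⟩ := Adversary.run_programOracle_univ hideal hv
  exact ⟨hrun, Prod.ext hcommitted rfl⟩

end Transfer

/-! ### The advantage -/

/-- The law of the adversary's coins, the challenge bit, the message and the randomness. -/
noncomputable def challengeMeasure (F : Type*) [Fintype F] [Nonempty F] [MeasurableSpace F]
    (K T : ℕ) : Measure ((ℕ → Bool) × Bool × (Fin K → F) × (Fin T → F)) :=
  coinTosses.prod ((uniformMeasure Bool).prod
    ((uniformMeasure (Fin K → F)).prod (uniformMeasure (Fin T → F))))

instance (F : Type*) [Fintype F] [Nonempty F] [MeasurableSpace F] (K T : ℕ) :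
    IsProbabilityMeasure (challengeMeasure F K T) :=
  inferInstanceAs (IsProbabilityMeasure (Measure.prod _ _))

section Advantage

variable {κ ℓ N K T q : ℕ} {F : Type*} [Field F] [Fintype F] [MeasurableSpace F]
  [MeasurableSingletonClass F] {α : Fin N → F} {enc : F → Fin ℓ → Bool} {A : Adversary κ F N}

theorem le_measure_idealRun_eq_some (hK : 0 < K) (hα : Function.Injective α)
    (henc : Function.Injective enc) (hA : A.QueriesAtMost q) (H : Oracle κ)
    (y : Fin N → Digest κ) (x : Equiv.Perm Bool) :
    (1 - q * (Fintype.card F : ℝ≥0∞)⁻¹) / 2 ≤ challengeMeasure F K T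
      {ω | A.idealRun H enc T y (heccEncode α ω.2.2.1 ω.2.2.2) ω.1 = some (x ω.2.1)} := by
  refine le_prod_of_forall_le _ _ fun coins => ?_
  rw [uniformMeasure_prod]
  refine le_of_le_of_eq ?_ (prod_uniformMeasure_bool_eq_some _
    (fun w : (Fin K → F) × (Fin T → F) =>
      A.idealRun H enc T y (heccEncode α w.1 w.2) coins) x).symm
  have hsalts : IsWiseUniform (T + 1)
      (fun w : (Fin K → F) × (Fin T → F) => heccEncode α w.1 w.2)
      (uniformMeasure ((Fin K → F) × (Fin T → F))) := fun Q hQ =>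
    isWiseUniform_heccEncode hα Q (by omega)
  have hnone := Adversary.measure_idealRun_eq_none_le H y hsalts henc hA coins
  have hcompl : {w : (Fin K → F) × (Fin T → F) |
      A.idealRun H enc T y (heccEncode α w.1 w.2) coins ≠ none} =
        {w | A.idealRun H enc T y (heccEncode α w.1 w.2) coins = none}ᶜ := rfl
  rw [hcompl, prob_compl_eq_one_sub (Set.toFinite _).measurableSet]
  exact ENNReal.div_le_div_right (tsub_le_tsub_left hnone 1) 2

theorem le_measure_run_eq (hK : 0 < K) (hα : Function.Injective α)
    (henc : Function.Injective enc) (hA : A.QueriesAtMost q) (x : Equiv.Perm Bool) :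
    (1 - q * (Fintype.card F : ℝ≥0∞)⁻¹) / 2 ≤ ((randomOracle κ).prod (challengeMeasure F K T))
      {ω | A.run ω.1 enc T ω.2.2.1 (heccEncode α ω.2.2.2.1 ω.2.2.2.2) ω.2.1 = x ω.2.2.1} := by
  refine le_trans (le_prod_of_forall_le ((randomOracle κ).prod (leafDigests κ N))
    (challengeMeasure F K T) (s := {ω | A.idealRun ω.1.1 enc T ω.1.2
      (heccEncode α ω.2.2.2.1 ω.2.2.2.2) ω.2.1 = some (x ω.2.2.1)}) fun p =>
        le_measure_idealRun_eq_some hK hα henc hA p.1 p.2 x) ?_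
  exact measure_idealRun_le_measure_run (challengeMeasure F K T)
    (coins := fun ω => ω.1) (b := fun ω => ω.2.1) (x := fun ω => x ω.2.1)
    (r := fun ω => heccEncode α ω.2.2.1 ω.2.2.2) (by fun_prop) (by fun_prop)
    ((Measurable.of_discrete (f := fun w : (Fin K → F) × (Fin T → F) =>
      heccEncode α w.1 w.2)).comp (by fun_prop)) (by fun_prop) enc T A

end Advantage

/-! ### Negligible functions -/

theorem Negligible.mono {f g : ℕ → ℝ} (hg : Negligible g) (h : ∀ n, f n ≤ g n) : Negligible f :=
  fun c hc => (hg c hc).imp fun _ hn₀ n hn => (h n).trans_lt (hn₀ n hn)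

theorem tendsto_polynomial_eval_div_two_pow (p : Polynomial ℕ) :
    Filter.Tendsto (fun n : ℕ => ((p.eval n : ℕ) : ℝ) / 2 ^ n) Filter.atTop (nhds 0) := by
  induction p using Polynomial.induction_on' with
  | add p q hp hq => simpa [add_div] using hp.add hq
  | monomial k a =>
    have h := (tendsto_pow_const_div_const_pow_of_one_lt k (one_lt_two (α := ℝ))).const_mul (a : ℝ)
    simpa [Polynomial.eval_monomial, mul_div_assoc] using h

theorem negligible_polynomial_eval_div_two_pow (p : Polynomial ℕ) :
    Negligible fun n => ((p.eval n : ℕ) : ℝ) / 2 ^ n := by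
  intro c _
  obtain ⟨k, hk⟩ := exists_nat_ge c
  obtain ⟨n₀, hn₀⟩ := Filter.eventually_atTop.1
    (((tendsto_polynomial_eval_div_two_pow (p * Polynomial.X ^ k)).eventually_lt_const
      one_pos).and (Filter.eventually_ge_atTop 1))
  refine ⟨n₀, fun n hn => ?_⟩
  obtain ⟨hlt, hone⟩ := hn₀ n hn
  have hone' : (1 : ℝ) ≤ n := by exact_mod_cast hone
  rw [lt_div_iff₀ (by positivity)]
  calc
    ((p.eval n : ℕ) : ℝ) / 2 ^ n * (n : ℝ) ^ c ≤ ((p.eval n : ℕ) : ℝ) / 2 ^ n * (n : ℝ) ^ k := by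
      gcongr
      exact (Real.rpow_le_rpow_of_exponent_le hone' hk).trans_eq (Real.rpow_natCast _ _)
    _ = (((p * Polynomial.X ^ k).eval n : ℕ) : ℝ) / 2 ^ n := by
      rw [Polynomial.eval_mul, Polynomial.eval_pow, Polynomial.eval_X, Nat.cast_mul, Nat.cast_pow,
        mul_div_right_comm]
    _ < 1 := hlt

theorem negligible_polynomial_eval_div_two_mul (p : Polynomial ℕ) {f : ℕ → ℕ}
    (hf : ∀ n, 2 ^ n ≤ f n) : Negligible fun n => ((p.eval n : ℕ) : ℝ) / (2 * f n) := by
  refine (negligible_polynomial_eval_div_two_pow p).mono fun n => ?_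
  have hfn : (2 : ℝ) ^ n ≤ f n := by exact_mod_cast hf n
  gcongr
  linarith [Nat.cast_nonneg (α := ℝ) (f n)]

/-! ### Hiding -/

theorem half_sub_div_le_toReal (q : ℕ) {n : ℕ} (hn : n ≠ 0) :
    1 / 2 - q / (2 * n) ≤ ((1 - q * (n : ℝ≥0∞)⁻¹) / 2).toReal := by
  have htop : (q * (n : ℝ≥0∞)⁻¹) ≠ ∞ :=
    ENNReal.mul_ne_top (ENNReal.natCast_ne_top q) (by simpa using hn)
  have h := ENNReal.le_toReal_sub (a := 1) htop
  rw [ENNReal.toReal_mul, ENNReal.toReal_inv, ENNReal.toReal_one, ENNReal.toReal_natCast,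
    ENNReal.toReal_natCast] at h
  rw [ENNReal.toReal_div, ENNReal.toReal_ofNat]
  calc
    (1 / 2 - q / (2 * n) : ℝ) = (1 - q * (n : ℝ)⁻¹) / 2 := by ring
    _ ≤ _ := by gcongr

theorem mainTheorem1_general {κ ℓ N K T q : ℕ} {F : Type*} [Field F] [Fintype F]
    {α : Fin N → F} {enc : F → Fin ℓ → Bool} {A : Adversary κ F N} (hK : 0 < K)
    (hα : Function.Injective α) (henc : Function.Injective enc) (hA : A.QueriesAtMost q) :
    |successProbability K T α enc A - 1 / 2| ≤ q / (2 * Fintype.card F) := by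
  let : MeasurableSpace F := ⊤
  have hsuccess : MeasurableSet
      {ω : Oracle κ × (ℕ → Bool) × Bool × (Fin K → F) × (Fin T → F) |
        A.run ω.1 enc T ω.2.2.1 (heccEncode α ω.2.2.2.1 ω.2.2.2.2) ω.2.1 = ω.2.2.1} :=
    measurableSet_eq_fun (A.measurable_run (by fun_prop) (by fun_prop) (by fun_prop)
      ((Measurable.of_discrete (f := fun w : (Fin K → F) × (Fin T → F) =>
        heccEncode α w.1 w.2)).comp (by fun_prop)) enc T) (by fun_prop)
  have hle (x : Equiv.Perm Bool) := (half_sub_div_le_toReal q Fintype.card_ne_zero).trans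
    (ENNReal.toReal_mono (measure_ne_top _ _) (le_measure_run_eq (T := T) hK hα henc hA x))
  have hfail := hle Equiv.boolNot
  simp only [Equiv.boolNot_apply, Bool.eq_not] at hfail
  exact (abs_measureReal_sub_half_le hsuccess (hle (Equiv.refl Bool)) hfail).trans_eq (by ring)

theorem mainTheorem1
    (F : ℕ → Type*) [∀ κ, Field (F κ)] [∀ κ, Fintype (F κ)]
    (hF : ∀ κ, 2 ^ κ ≤ Fintype.card (F κ))
    (N K T : ℕ → ℕ) (hK : ∀ κ, 0 < K κ) (hT : ∀ κ, 0 < T κ) (hN : ∀ κ, K κ + T κ ≤ N κ)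
    (α : ∀ κ, Fin (N κ) → F κ) (hα : ∀ κ, Function.Injective (α κ))
    (ℓ : ℕ → ℕ) (enc : ∀ κ, F κ → Fin (ℓ κ) → Bool) (henc : ∀ κ, Function.Injective (enc κ))
    (A : ∀ κ, Adversary κ (F κ) (N κ))
    (p : Polynomial ℕ) (hA : ∀ κ, (A κ).QueriesAtMost (p.eval κ)) :
    Negligible fun κ => |successProbability (K κ) (T κ) (α κ) (enc κ) (A κ) - 1 / 2| := by
  exact (negligible_polynomial_eval_div_two_mul p hF).mono fun κ =>
    mainTheorem1_general (hK κ) (hα κ) (henc κ) (hA κ)
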